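/- All $C^*$-algebras are unital, representations of $C^*$-algebras on Hilbert spaces are unital, and "representation" of a $C^*$-correspondence means completely contractive covariant representation. Let $\mathcal A$ be a $C^*$-algebra and $\mathcal H$ a Hilbert space. (1) Let $E$ be a $C^*$-correspondence over $\mathcal A$ and let $(S,\rho)$ be a representation of $E$ on $\mathcal H$, that is, a completely contractive linear map $S:E\to\mathcal B(\mathcal H)$ and a representation $\rho$ of $\mathcal A$ on $\mathcal H$ with $S(a\xi b)=\rho(a)S(\xi)\rho(b)$. Suppose that $(S,\rho)$ is fully coisometric, i.e. the operator $\tilde S:E\otimes_\rho\mathcal H\to\mathcal H$, $\tilde S(\xi\otimes h)=S(\xi)h$, satisfies $\tilde S\tilde S^*=I$, and finitely correlated, i.e. it is isometric ($S(\xi)^*S(\eta)=\rho(\langle\xi,\eta\rangle)$) and is the minimal isometric dilation of a representation of $E$ on a nonzero finite-dimensional subspace of $\mathcal H$. Here $(S,\rho)$ is a minimal isometric dilation of a representation $(A,\sigma)$ on $\mathcal V\subseteq\mathcal H$ if it is isometric, $\mathcal V$ reduces $\rho$ and $\rho(\cdot)|_{\mathcal V}=\sigma$, $\mathcal V^\perp$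 is invariant under $S(\xi)$ and $P_{\mathcal V}S(\xi)|_{\mathcal V}=A(\xi)$ for all $\xi\in E$, and $\mathcal H$ is the closed linear span of the vectors $S(\xi_1)\cdots S(\xi_n)v$ with $n\ge 0$, $\xi_i\in E$, $v\in\mathcal V$. Let $\mathfrak S$ be the unital WOT-closed algebra generated by $S(E)$ and $\rho(\mathcal A)$, and let $\mathcal V$ be a finite-dimensional subspace of $\mathcal H$, invariant under $\mathfrak S^*=\{X^*:X\in\mathfrak S\}$, such that $(S,\rho)$ is the minimal isometric dilation of its compression $(P_{\mathcal V}S(\cdot)|_{\mathcal V},\rho(\cdot)|_{\mathcal V})$. Then every nonzero closed $\mathfrak S^*$-invariant subspace $\mathcal M$ of $\mathcal H$ satisfies $\mathcal M\cap\mathcal V\ne\{0\}$. (2) Let $E=(E(\mathbf n))_{\mathbf n\in\mathbb N^k}$ be a product system of $C^*$-correspondences over $\mathcal A$, that is, $E(\mathbf 0)=\mathcal A$ and there is an associative multiplication that extends to isomorphisms $E(\mathbf n)\otimes E(\mathbf m)\cong E(\mathbf n+\mathbf m)$ and is given by the left and right actions of $\mathcal A$ when one factor lies in $E(\mathbf 0)$.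 Put $E_i=E(\mathbf e_i)$ and let $t_{i,j}:E_i\otimes E_j\to E_j\otimes E_i$ be the induced isomorphisms. Let $(S^{(1)},\dots,S^{(k)},\rho)$ be a representation of $E$ on $\mathcal H$: each $(S^{(i)},\rho)$ is a representation of $E_i$, and $\tilde S^{(i)}(I_{E_i}\otimes\tilde S^{(j)})=\tilde S^{(j)}(I_{E_j}\otimes\tilde S^{(i)})(t_{i,j}\otimes I_{\mathcal H})$. It is called isometric, fully coisometric, or a dilation of a representation $(A^{(1)},\dots,A^{(k)},\sigma)$ on a subspace if every $(S^{(i)},\rho)$ is isometric, fully coisometric, or a dilation of $(A^{(i)},\sigma)$ respectively; an isometric dilation of a representation on $\mathcal V$ is minimal if $\mathcal H$ is the closed linear span of the vectors $S^{(i_1)}(\xi_1)\cdots S^{(i_r)}(\xi_r)v$ with $r\ge0$, $i_1\le\dots\le i_r$, $\xi_s\in E_{i_s}$, $v\in\mathcal V$; and finitely correlated is defined as in (1). Suppose that $(S^{(1)},\dots,S^{(k)},\rho)$ is finitely correlated and fully coisometric, let $\mathfrak S$ be the unital WOT-closed algebra generated by all $S^{(i)}(E_i)$ and $\rho(\mathcal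 A)$, and let $\mathcal V$ be a finite-dimensional $\mathfrak S^*$-invariant subspace of $\mathcal H$ such that $(S^{(1)},\dots,S^{(k)},\rho)$ is a minimal isometric dilation of its compression $(P_{\mathcal V}S^{(1)}(\cdot)|_{\mathcal V},\dots,P_{\mathcal V}S^{(k)}(\cdot)|_{\mathcal V},\rho(\cdot)|_{\mathcal V})$. Then every nonzero closed $\mathfrak S^*$-invariant subspace $\mathcal M$ of $\mathcal H$ satisfies $\mathcal M\cap\mathcal V\neq\{0\}$. -/

import Mathlib

open scoped InnerProductSpace TensorProduct

/-! ## C⋆-correspondences -/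

/-- A C⋆-correspondence over the unital C⋆-algebra `A`: a complete right Hilbert C⋆-module `E`
over `A` (right modules are `Aᵐᵒᵖ`-modules, so `MulOpposite.op a • ξ` is `ξ a`) with an
`A`-valued inner product `⟪ξ, η⟫_A` that is linear in the second variable, together with a
homomorphism `left` of `A` into the adjointable operators of `E`. (Mathlib's `CStarModule` has
`⟪ξ, a • η⟫ = a * ⟪ξ, η⟫`, that is, it describes left modules.) The left action need not be
unital. -/
class CStarCorrespondence (A E : Type*) [CStarAlgebra A] [PartialOrder A] [StarOrderedRing A]
    [NormedAddCommGroup E] [NormedSpace ℂ E] [CompleteSpace E] [Module Aᵐᵒᵖ E]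
    extends Inner A E where
  inner_add_right (ξ η ζ : E) : inner ξ (η + ζ) = inner ξ η + inner ξ ζ
  inner_smul_right (c : ℂ) (ξ η : E) : inner ξ (c • η) = c • inner ξ η
  inner_op_smul_right (a : A) (ξ η : E) : inner ξ (MulOpposite.op a • η) = inner ξ η * a
  star_inner (ξ η : E) : star (inner ξ η) = inner η ξ
  inner_self_nonneg (ξ : E) : 0 ≤ inner ξ ξ
  inner_self_eq_zero (ξ : E) : inner ξ ξ = 0 ↔ ξ = 0
  norm_eq (ξ : E) : ‖ξ‖ = √‖inner ξ ξ‖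
  /-- the left action of `A` -/
  left : A →ₙₐ[ℂ] Module.End ℂ E
  inner_left (a : A) (ξ η : E) : inner (left a ξ) η = inner ξ (left (star a) η)

/-- The left action `a ξ` of `A` on a C⋆-correspondence. -/
noncomputable def CStarCorrespondence.lact {A E : Type*} [CStarAlgebra A] [PartialOrder A] [StarOrderedRing A]
    [NormedAddCommGroup E] [NormedSpace ℂ E] [CompleteSpace E] [Module Aᵐᵒᵖ E]
    [CStarCorrespondence A E] (a : A) (ξ : E) : E :=
  CStarCorrespondence.left (A := A) (E := E) a ξ

open CStarCorrespondence

theorem exists_star_mul_self {B : Type*} [CStarAlgebra B] [PartialOrder B] [StarOrderedRing B]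
    {G : B} (hG : 0 ≤ G) : ∃ C : B, G = star C * C :=
  CStarAlgebra.nonneg_iff_eq_star_mul_self.mp hG

/-- The properties of the negative part that are used below. -/
theorem exists_negPart {B : Type*} [CStarAlgebra B] [PartialOrder B] [StarOrderedRing B]
    {G : B} (hsa : IsSelfAdjoint G) :
    ∃ N : B, star N = N ∧ 0 ≤ N * N * N ∧ N * G * N = -(N * N * N) ∧
      (N * N * N = 0 → 0 ≤ G) := by
  have hN0 : 0 ≤ G⁻ := CFC.negPart_nonneg G
  have hNs : star G⁻ = G⁻ := hN0.isSelfAdjoint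
  refine ⟨G⁻, hNs, ?_, ?_, fun h => ?_⟩
  · have := star_left_conjugate_nonneg hN0 G⁻
    rwa [hNs] at this
  · nth_rewrite 2 [← CFC.posPart_sub_negPart G hsa]
    rw [mul_sub, CFC.negPart_mul_posPart, zero_sub, neg_mul]
  · have hNN : G⁻ * G⁻ = 0 := by
      have : star (G⁻ * G⁻) * (G⁻ * G⁻) = 0 := by
        rw [star_mul, hNs, ← mul_assoc, h, zero_mul]
      exact CStarRing.star_mul_self_eq_zero_iff _ |>.mp this
    have hNz : G⁻ = 0 := by
      have : star G⁻ * G⁻ = 0 := by rw [hNs, hNN]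
      exact CStarRing.star_mul_self_eq_zero_iff _ |>.mp this
    exact (CFC.negPart_eq_zero_iff G hsa).mp hNz

section Gram

variable {A E H : Type*} [CStarAlgebra A] [PartialOrder A] [StarOrderedRing A]
  [NormedAddCommGroup E] [NormedSpace ℂ E] [CompleteSpace E] [Module Aᵐᵒᵖ E]
  [CStarCorrespondence A E]
  [NormedAddCommGroup H] [InnerProductSpace ℂ H] [CompleteSpace H]

/-- The square `(∑ₖ ⟪ξₖᵢ, ξₖⱼ⟫)ᵢⱼ ∈ Mₙ(A)` of a matrix `ξ ∈ Mₙ(E)`. The operator space norm of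
`ξ` is the square root of the norm of this element of the C⋆-algebra `Mₙ(A)`. -/
noncomputable def matrixSq (A : Type*) {E : Type*} [CStarAlgebra A] [PartialOrder A]
    [StarOrderedRing A] [NormedAddCommGroup E] [NormedSpace ℂ E] [CompleteSpace E]
    [Module Aᵐᵒᵖ E] [CStarCorrespondence A E] {n : ℕ} (ξ : Fin n → Fin n → E) :
    CStarMatrix (Fin n) (Fin n) A :=
  CStarMatrix.ofMatrix (Matrix.of fun i j => ∑ k, ⟪ξ k i, ξ k j⟫_A)

theorem CStarCorrespondence.inner_add_left (ξ η ζ : E) :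
    ⟪ξ + η, ζ⟫_A = ⟪ξ, ζ⟫_A + ⟪η, ζ⟫_A := by
  rw [← star_inner (A := A), inner_add_right, star_add, star_inner, star_inner]

theorem CStarCorrespondence.inner_smul_left (c : ℂ) (ξ η : E) :
    ⟪c • ξ, η⟫_A = star c • ⟪ξ, η⟫_A := by
  rw [← star_inner (A := A), inner_smul_right, star_smul, star_inner]

theorem CStarCorrespondence.inner_op_smul_left (a : A) (ξ η : E) :
    ⟪MulOpposite.op a • ξ, η⟫_A = star a * ⟪ξ, η⟫_A := by
  rw [← star_inner (A := A), inner_op_smul_right, star_mul, star_inner]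

theorem CStarCorrespondence.inner_sum_right {ι : Type*} (s : Finset ι) (ξ : E) (f : ι → E) :
    ⟪ξ, ∑ i ∈ s, f i⟫_A = ∑ i ∈ s, ⟪ξ, f i⟫_A :=
  map_sum (AddMonoidHom.mk' (fun η : E => ⟪ξ, η⟫_A) (inner_add_right ξ)) f s

theorem CStarCorrespondence.inner_sum_left {ι : Type*} (s : Finset ι) (ξ : E) (f : ι → E) :
    ⟪∑ i ∈ s, f i, ξ⟫_A = ∑ i ∈ s, ⟪f i, ξ⟫_A :=
  map_sum (AddMonoidHom.mk' (fun η : E => ⟪η, ξ⟫_A) (fun _ _ => inner_add_left _ _ _)) f s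

/-- Gram matrices are positive in `Mₙ(A)`. -/
theorem gram_nonneg {n : ℕ} (ξ : Fin n → E) :
    0 ≤ CStarMatrix.ofMatrix (Matrix.of fun i j => ⟪ξ i, ξ j⟫_A) := by
  set G : CStarMatrix (Fin n) (Fin n) A :=
    CStarMatrix.ofMatrix (Matrix.of fun i j => ⟪ξ i, ξ j⟫_A) with hG
  have hGe : ∀ i j, G i j = ⟪ξ i, ξ j⟫_A := fun i j => rfl
  have hsa : IsSelfAdjoint G := by
    ext i j
    rw [CStarMatrix.star_apply]
    simp only [hGe, star_inner]
  have hdiag : ∀ (X : CStarMatrix (Fin n) (Fin n) A) (k : Fin n),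
      0 ≤ (star X * G * X) k k := by
    intro X k
    have h := inner_self_nonneg (A := A) (∑ i, MulOpposite.op (X i k) • ξ i)
    have e : ⟪∑ i, MulOpposite.op (X i k) • ξ i, ∑ i, MulOpposite.op (X i k) • ξ i⟫_A
        = (star X * G * X) k k := by
      rw [CStarCorrespondence.inner_sum_right]
      simp only [CStarCorrespondence.inner_sum_left, inner_op_smul_right, inner_op_smul_left,
        CStarMatrix.mul_apply, CStarMatrix.star_apply, hGe, Finset.sum_mul]
    rw [← e]
    exact h
  obtain ⟨N, hNs, hN3, hGN, hfin⟩ := exists_negPart hsa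
  obtain ⟨C, hC⟩ := exists_star_mul_self hN3
  have hC0 : C = 0 := by
    ext l k
    have h1 := hdiag N k
    rw [hNs, hGN, hC] at h1
    have h2 : (star C * C) k k = ∑ l, star (C l k) * C l k := by
      simp only [CStarMatrix.mul_apply, CStarMatrix.star_apply]
    have h3 : (-(star C * C)) k k = -((star C * C) k k) := rfl
    rw [h3, h2] at h1
    have h4 : ∑ l, star (C l k) * C l k = 0 :=
      le_antisymm (neg_nonneg.mp h1) (Finset.sum_nonneg fun l _ => star_mul_self_nonneg _)
    have h5 := (Finset.sum_eq_zero_iff_of_nonneg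
      (fun l _ => star_mul_self_nonneg (C l k))).mp h4 l (Finset.mem_univ l)
    exact CStarRing.star_mul_self_eq_zero_iff _ |>.mp h5
  exact hfin (by rw [hC, hC0]; simp)

end Gram

/-! ## The Hilbert space `E ⊗_σ H` -/

section Tensor

variable {A H : Type*} [CStarAlgebra A] [PartialOrder A] [StarOrderedRing A]
  [NormedAddCommGroup H] [InnerProductSpace ℂ H] [CompleteSpace H]

/-- The algebraic tensor product of `E` and `H`, to be given the semi-inner product
`⟪ξ₁ ⊗ h₁, ξ₂ ⊗ h₂⟫ = ⟪h₁, σ ⟪ξ₁, ξ₂⟫ h₂⟫`. -/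
def PreTensor (E : Type*) [NormedAddCommGroup E] [NormedSpace ℂ E]
    (_σ : A →⋆ₐ[ℂ] (H →L[ℂ] H)) : Type _ := E ⊗[ℂ] H

variable (E : Type*) [NormedAddCommGroup E] [NormedSpace ℂ E]
  (σ : A →⋆ₐ[ℂ] (H →L[ℂ] H))

noncomputable instance : AddCommGroup (PreTensor E σ) :=
  inferInstanceAs (AddCommGroup (E ⊗[ℂ] H))

noncomputable instance : Module ℂ (PreTensor E σ) :=
  inferInstanceAs (Module ℂ (E ⊗[ℂ] H))

variable [CompleteSpace E] [Module Aᵐᵒᵖ E] [CStarCorrespondence A E]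

/-- The sesquilinear form `(ξ₁ ⊗ h₁, ξ₂ ⊗ h₂) ↦ ⟪h₁, σ ⟪ξ₁, ξ₂⟫ h₂⟫`. -/
noncomputable def preTensorForm : (E ⊗[ℂ] H) →ₗ⋆[ℂ] (E ⊗[ℂ] H) →ₗ[ℂ] ℂ :=
  TensorProduct.lift
    (LinearMap.mk₂'ₛₗ (starRingEnd ℂ) (starRingEnd ℂ)
      (fun (ξ : E) (h : H) => TensorProduct.lift
        (LinearMap.mk₂ ℂ (fun (η : E) (g : H) => ⟪h, σ ⟪ξ, η⟫_A g⟫_ℂ)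
          (by intro η η' g; simp [CStarCorrespondence.inner_add_right])
          (by intro c η g; simp [CStarCorrespondence.inner_smul_right])
          (by intro η g g'; simp)
          (by intro c η g; simp)))
      (by
        intro ξ ξ' h; ext η g
        simp [CStarCorrespondence.inner_add_left])
      (by
        intro c ξ h; ext η g
        simp [CStarCorrespondence.inner_smul_left])
      (by intro ξ h h'; ext η g; simp)
      (by intro c ξ h; ext η g; simp [mul_comm]))

theorem preTensorForm_tmul (ξ η : E) (h g : H) :
    preTensorForm E σ (ξ ⊗ₜ h) (η ⊗ₜ g) = ⟪h, σ ⟪ξ, η⟫_A g⟫_ℂ := rfl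

theorem preTensorForm_symm (x y : E ⊗[ℂ] H) :
    (starRingEnd ℂ) (preTensorForm E σ y x) = preTensorForm E σ x y := by
  induction x using TensorProduct.induction_on with
  | zero => simp
  | add x x' hx hx' => simp [hx, hx']
  | tmul ξ h =>
    induction y using TensorProduct.induction_on with
    | zero => simp
    | add y y' hy hy' => simp [hy, hy']
    | tmul η g =>
      rw [preTensorForm_tmul, preTensorForm_tmul, inner_conj_symm,
        ← CStarCorrespondence.star_inner (A := A) ξ η, map_star,
        ContinuousLinearMap.star_eq_adjoint, ContinuousLinearMap.adjoint_inner_left]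

theorem preTensorForm_nonneg (x : E ⊗[ℂ] H) : 0 ≤ RCLike.re (preTensorForm E σ x x) := by
  obtain ⟨n, ξ, h, rfl⟩ := TensorProduct.exists_sum_tmul_eq x
  obtain ⟨B, hB⟩ := exists_star_mul_self (gram_nonneg (A := A) ξ)
  have hB' : ∀ i j, ⟪ξ i, ξ j⟫_A = ∑ k, star (B k i) * B k j := by
    intro i j
    have := congrFun (congrFun hB i) j
    simpa [CStarMatrix.mul_apply, CStarMatrix.star_apply] using this
  have key : preTensorForm E σ (∑ j, ξ j ⊗ₜ h j) (∑ j, ξ j ⊗ₜ h j)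
      = ∑ k, ⟪∑ i, σ (B k i) (h i), ∑ i, σ (B k i) (h i)⟫_ℂ := by
    simp only [map_sum, LinearMap.sum_apply, preTensorForm_tmul, hB', sum_inner, inner_sum,
      map_mul, map_star, _root_.sum_apply, mul_apply_eq_comp,
      ContinuousLinearMap.star_eq_adjoint, ContinuousLinearMap.adjoint_inner_right]
    rw [Finset.sum_comm]
    rw [Finset.sum_congr rfl fun _ _ => Finset.sum_comm]
    rw [Finset.sum_comm]
    refine Finset.sum_congr rfl fun k _ => ?_
    rw [Finset.sum_comm]
  rw [key, map_sum]
  exact Finset.sum_nonneg fun k _ => inner_self_nonneg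

noncomputable instance preTensorCore : PreInnerProductSpace.Core ℂ (PreTensor E σ) where
  inner x y := preTensorForm E σ x y
  conj_inner_symm x y := preTensorForm_symm E σ x y
  re_inner_nonneg x := preTensorForm_nonneg E σ x
  add_left x y z := by
    rw [show preTensorForm E σ (x + y) = preTensorForm E σ x + preTensorForm E σ y from
      map_add (preTensorForm E σ) x y]
    rfl
  smul_left x y r := by
    rw [show preTensorForm E σ (r • x) = (starRingEnd ℂ) r • preTensorForm E σ x from
      map_smulₛₗ (preTensorForm E σ) r x]
    rfl

noncomputable instance : SeminormedAddCommGroup (PreTensor E σ) :=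
  InnerProductSpace.Core.toSeminormedAddCommGroup (𝕜 := ℂ)

noncomputable instance : InnerProductSpace ℂ (PreTensor E σ) :=
  InnerProductSpace.ofCore (preTensorCore E σ)

/-- The Hilbert space `E ⊗_σ H`: the Hausdorff completion of the algebraic tensor product. -/
abbrev TensorHilbert : Type _ := UniformSpace.Completion (PreTensor E σ)

variable {E} in
/-- The elementary tensor `ξ ⊗ h` in `E ⊗_σ H`. -/
noncomputable def tensorMk (ξ : E) (h : H) : TensorHilbert E σ :=
  ((show PreTensor E σ from ξ ⊗ₜ[ℂ] h : PreTensor E σ) : UniformSpace.Completion (PreTensor E σ))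

variable {E} in
theorem inner_tensorMk (ξ η : E) (h g : H) :
    ⟪tensorMk σ ξ h, tensorMk σ η g⟫_ℂ = ⟪h, σ ⟪ξ, η⟫_A g⟫_ℂ :=
  UniformSpace.Completion.inner_coe (𝕜 := ℂ) (E := PreTensor E σ) _ _

end Tensor

/-! ## Representations of C⋆-correspondences -/

section Rep

variable (A E H : Type*) [CStarAlgebra A] [PartialOrder A] [StarOrderedRing A]
  [NormedAddCommGroup E] [NormedSpace ℂ E] [CompleteSpace E] [Module Aᵐᵒᵖ E]
  [CStarCorrespondence A E]
  [NormedAddCommGroup H] [InnerProductSpace ℂ H] [CompleteSpace H]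

/-- A (completely contractive covariant) representation `(S, ρ)` of `E` on `H`. -/
structure CorrRep where
  /-- the linear map `S : E → B(H)` -/
  map : E →ₗ[ℂ] (H →L[ℂ] H)
  /-- the unital representation `ρ` of `A` on `H` -/
  rho : A →⋆ₐ[ℂ] (H →L[ℂ] H)
  /-- `S (a ξ b) = ρ a S(ξ) ρ b` -/
  covariant (a b : A) (ξ : E) :
    map (lact a (MulOpposite.op b • ξ)) = rho a * map ξ * rho b
  /-- For every `ξ ∈ Mₙ(E)` the operator `(S (ξᵢⱼ))ᵢⱼ` on `Hⁿ` has norm at most `‖ξ‖`. -/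
  completelyContractive (n : ℕ) (ξ : Fin n → Fin n → E) (h : Fin n → H) :
    ∑ i, ‖∑ j, map (ξ i j) (h j)‖ ^ 2 ≤ ‖matrixSq A ξ‖ * ∑ j, ‖h j‖ ^ 2

end Rep

/-- The unital WOT-closed subalgebra of `B(H)` generated by a set of operators. -/
def wotAlgebra {H : Type*} [NormedAddCommGroup H] [InnerProductSpace ℂ H]
    (s : Set (H →L[ℂ] H)) : Set (H →L[ℂ] H) :=
  {X | ContinuousLinearMapWOT.ofCLM X ∈
    closure (ContinuousLinearMapWOT.ofCLM '' (Algebra.adjoin ℂ s : Set (H →L[ℂ] H)))}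

theorem subset_wotAlgebra {H : Type*} [NormedAddCommGroup H] [InnerProductSpace ℂ H]
    (s : Set (H →L[ℂ] H)) : s ⊆ wotAlgebra s := fun _ hX =>
  subset_closure ⟨_, Algebra.subset_adjoin hX, rfl⟩

/-- `M` is `𝔖⋆`-invariant: `X⋆ M ⊆ M` for all `X ∈ 𝔖`. -/
def StarInvariant {H : Type*} [NormedAddCommGroup H] [InnerProductSpace ℂ H] [CompleteSpace H]
    (𝔖 : Set (H →L[ℂ] H)) (M : Submodule ℂ H) : Prop :=
  ∀ X ∈ 𝔖, ∀ x ∈ M, ContinuousLinearMap.adjoint X x ∈ M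

theorem StarInvariant.orthogonal {H : Type*} [NormedAddCommGroup H] [InnerProductSpace ℂ H]
    [CompleteSpace H] {𝔖 : Set (H →L[ℂ] H)} {M : Submodule ℂ H} (hM : StarInvariant 𝔖 M)
    {X : H →L[ℂ] H} (hX : X ∈ 𝔖) {x : H} (hx : x ∈ Mᗮ) : X x ∈ Mᗮ := by
  rw [Submodule.mem_orthogonal] at hx ⊢
  intro u hu
  rw [← ContinuousLinearMap.adjoint_inner_left]
  exact hx _ (hM X hX u hu)

/-- `V` reduces the representation `ρ` of `A`, and `ρ(·)|_V = σ`. -/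
def ReducesTo {A H : Type*} [CStarAlgebra A]
    [NormedAddCommGroup H] [InnerProductSpace ℂ H] [CompleteSpace H]
    (ρ : A →⋆ₐ[ℂ] (H →L[ℂ] H)) (V : Submodule ℂ H) [CompleteSpace V]
    (σ : A →⋆ₐ[ℂ] (V →L[ℂ] V)) : Prop :=
  ∀ a : A, (∀ v ∈ V, ρ a v ∈ V) ∧ (∀ v ∈ Vᗮ, ρ a v ∈ Vᗮ) ∧ ∀ v : V, ρ a v = σ a v

section Compression

variable {A H : Type*} [CStarAlgebra A]
  [NormedAddCommGroup H] [InnerProductSpace ℂ H] [CompleteSpace H]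

/-- The compression `P_V X|_V` of `X ∈ B(H)` to `V`. -/
noncomputable def compressOp (V : Submodule ℂ H) [CompleteSpace V] (X : H →L[ℂ] H) :
    V →L[ℂ] V :=
  V.orthogonalProjectionOnto ∘L X ∘L V.subtypeL

theorem compressOp_apply (V : Submodule ℂ H) [CompleteSpace V] (X : H →L[ℂ] H) (v : V) :
    compressOp V X v = V.orthogonalProjectionOnto (X v) := rfl

theorem coe_compressOp_of_mem (V : Submodule ℂ H) [CompleteSpace V] (X : H →L[ℂ] H)
    (hX : ∀ v ∈ V, X v ∈ V) (v : V) : (compressOp V X v : H) = X v := by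
  rw [compressOp_apply]
  exact Submodule.starProjection_eq_self_iff.mpr (hX v v.2)

theorem compressOp_mul_of_mem (V : Submodule ℂ H) [CompleteSpace V] (X Y : H →L[ℂ] H)
    (hY : ∀ v ∈ V, Y v ∈ V) : compressOp V (X * Y) = compressOp V X * compressOp V Y := by
  ext v
  change ((V.orthogonalProjectionOnto (X (Y v)) : V) : H)
    = V.orthogonalProjectionOnto (X (compressOp V Y v : H))
  rw [coe_compressOp_of_mem V Y hY]

theorem compressOp_mul_of_orthogonal (V : Submodule ℂ H) [CompleteSpace V] (X Y : H →L[ℂ] H)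
    (hX : ∀ x ∈ Vᗮ, X x ∈ Vᗮ) : compressOp V (X * Y) = compressOp V X * compressOp V Y := by
  ext v
  change ((V.orthogonalProjectionOnto (X (Y v)) : V) : H)
    = V.orthogonalProjectionOnto (X (V.orthogonalProjectionOnto (Y v) : H))
  have h1 : Y v - (V.orthogonalProjectionOnto (Y v) : H) ∈ Vᗮ :=
    Submodule.sub_starProjection_mem_orthogonal _
  have h2 := Submodule.orthogonalProjectionOnto_eq_zero_iff.mpr (hX _ h1)
  rw [map_sub, map_sub, sub_eq_zero] at h2
  rw [h2]

/-- The restriction `ρ(·)|_V` of `ρ` to an invariant subspace `V`. -/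
noncomputable def restrictRho (ρ : A →⋆ₐ[ℂ] (H →L[ℂ] H)) (V : Submodule ℂ H) [CompleteSpace V]
    (hV : ∀ a, ∀ v ∈ V, ρ a v ∈ V) : A →⋆ₐ[ℂ] (V →L[ℂ] V) where
  toFun a := compressOp V (ρ a)
  map_one' := by
    ext v
    rw [coe_compressOp_of_mem V _ (hV 1)]
    simp
  map_mul' a b := by rw [map_mul, compressOp_mul_of_mem V _ _ (hV b)]
  map_zero' := by
    ext v
    rw [coe_compressOp_of_mem V _ (hV 0)]
    simp
  map_add' a b := by
    ext v
    rw [coe_compressOp_of_mem V _ (hV _)]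
    simp [coe_compressOp_of_mem V _ (hV _)]
  commutes' c := by
    ext v
    rw [coe_compressOp_of_mem V _ (hV _)]
    simp [Algebra.algebraMap_eq_smul_one]
  map_star' a := by
    rw [ContinuousLinearMap.star_eq_adjoint, ContinuousLinearMap.eq_adjoint_iff]
    intro v w
    rw [Submodule.coe_inner, Submodule.coe_inner, coe_compressOp_of_mem V _ (hV _),
      coe_compressOp_of_mem V _ (hV _), map_star, ContinuousLinearMap.star_eq_adjoint,
      ContinuousLinearMap.adjoint_inner_left]

theorem coe_restrictRho (ρ : A →⋆ₐ[ℂ] (H →L[ℂ] H)) (V : Submodule ℂ H) [CompleteSpace V]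
    (hV : ∀ a, ∀ v ∈ V, ρ a v ∈ V) (a : A) (v : V) : (restrictRho ρ V hV a v : H) = ρ a v :=
  coe_compressOp_of_mem V _ (hV a) v

end Compression

namespace CorrRep

variable {A E H : Type*} [CStarAlgebra A] [PartialOrder A] [StarOrderedRing A]
  [NormedAddCommGroup E] [NormedSpace ℂ E] [CompleteSpace E] [Module Aᵐᵒᵖ E]
  [CStarCorrespondence A E]
  [NormedAddCommGroup H] [InnerProductSpace ℂ H] [CompleteSpace H]

/-- The representation is isometric: `S(ξ)⋆ S(η) = ρ ⟪ξ, η⟫`. -/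
def IsIsometric (S : CorrRep A E H) : Prop :=
  ∀ ξ η : E, ContinuousLinearMap.adjoint (S.map ξ) * S.map η = S.rho ⟪ξ, η⟫_A

/-- The representation is fully coisometric: the bounded operator `S̃ : E ⊗_ρ H → H` determined by
`S̃ (ξ ⊗ h) = S(ξ) h` is a coisometry, `S̃ S̃⋆ = I`. -/
def IsFullyCoisometric (S : CorrRep A E H) : Prop :=
  ∃ St : TensorHilbert E S.rho →L[ℂ] H, (∀ ξ h, St (tensorMk S.rho ξ h) = S.map ξ h) ∧
    St ∘L ContinuousLinearMap.adjoint St = ContinuousLinearMap.id ℂ H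

/-- The unital WOT-closed algebra generated by the representation. -/
def wotAlg (S : CorrRep A E H) : Set (H →L[ℂ] H) :=
  wotAlgebra (Set.range S.map ∪ Set.range S.rho)

theorem map_mem_wotAlg (S : CorrRep A E H) (ξ : E) : S.map ξ ∈ S.wotAlg :=
  subset_wotAlgebra _ (Or.inl ⟨ξ, rfl⟩)

theorem rho_mem_wotAlg (S : CorrRep A E H) (a : A) : S.rho a ∈ S.wotAlg :=
  subset_wotAlgebra _ (Or.inr ⟨a, rfl⟩)

theorem rho_mem_of_starInvariant (S : CorrRep A E H) {V : Submodule ℂ H}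
    (hV : StarInvariant S.wotAlg V) (a : A) (v : H) (hv : v ∈ V) : S.rho a v ∈ V := by
  have := hV _ (S.rho_mem_wotAlg (star a)) v hv
  rwa [← ContinuousLinearMap.star_eq_adjoint, ← map_star, star_star] at this

/-- The compression `(P_V S(·)|_V, ρ(·)|_V)` to a subspace `V` reducing `ρ`. -/
noncomputable def compress (S : CorrRep A E H) (V : Submodule ℂ H) [CompleteSpace V]
    (hV : ∀ a, ∀ v ∈ V, S.rho a v ∈ V) : CorrRep A E V where
  map :=
    { toFun := fun ξ => compressOp V (S.map ξ)
      map_add' := by intro ξ η; ext v; simp [compressOp_apply]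
      map_smul' := by intro c ξ; ext v; simp [compressOp_apply] }
  rho := restrictRho S.rho V hV
  covariant a b ξ := by
    have h : ∀ x ∈ Vᗮ, S.rho a x ∈ Vᗮ := by
      intro x hx
      rw [Submodule.mem_orthogonal] at hx ⊢
      intro u hu
      rw [← ContinuousLinearMap.adjoint_inner_left, ← ContinuousLinearMap.star_eq_adjoint,
        ← map_star]
      exact hx _ (hV _ u hu)
    change compressOp V (S.map _) = compressOp V (S.rho a) * compressOp V (S.map ξ)
      * compressOp V (S.rho b)
    rw [S.covariant, compressOp_mul_of_mem V _ _ (hV b), compressOp_mul_of_orthogonal V _ _ h]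
  completelyContractive n ξ h := by
    refine le_trans (Finset.sum_le_sum fun i _ => ?_)
      (S.completelyContractive n ξ fun j => (h j : H))
    have e : ∑ j, compressOp V (S.map (ξ i j)) (h j)
        = V.orthogonalProjectionOnto (∑ j, S.map (ξ i j) (h j : H)) := by
      rw [map_sum]; rfl
    change ‖∑ j, compressOp V (S.map (ξ i j)) (h j)‖ ^ 2 ≤ _
    rw [e]
    gcongr
    exact Submodule.norm_orthogonalProjectionOnto_apply_le V _

/-- `S` on `H` is a dilation of `T` on the subspace `V` of `H`: `V` reduces `ρ` with
`ρ(·)|_V = σ`, the subspace `Vᗮ` is invariant under every `S(ξ)`, and `P_V S(ξ)|_V = T(ξ)`. -/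
def IsDilation (S : CorrRep A E H) (V : Submodule ℂ H) [CompleteSpace V]
    (T : CorrRep A E V) : Prop :=
  ReducesTo S.rho V T.rho ∧ (∀ ξ, ∀ x ∈ Vᗮ, S.map ξ x ∈ Vᗮ) ∧
    ∀ ξ, compressOp V (S.map ξ) = T.map ξ

/-- The vector `S(ξ₁) ⋯ S(ξₙ) v = S̃ₙ (ξ₁ ⊗ ⋯ ⊗ ξₙ ⊗ v)`. -/
def word (S : CorrRep A E H) (l : List E) (v : H) : H :=
  l.foldr (fun ξ x => S.map ξ x) v

/-- `S` is the minimal isometric dilation of `T`: it is an isometric dilation, and `H` is the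
closed span of the spaces `S̃ₙ (Eⁿ ⊗ V)`, `n ≥ 0`, that is, of the vectors
`S(ξ₁) ⋯ S(ξₙ) v` with `n ≥ 0` and `v ∈ V`. -/
def IsMinimalIsometricDilation (S : CorrRep A E H) (V : Submodule ℂ H) [CompleteSpace V]
    (T : CorrRep A E V) : Prop :=
  S.IsDilation V T ∧ S.IsIsometric ∧
    (Submodule.span ℂ {x : H | ∃ (l : List E) (v : H), v ∈ V ∧ x = S.word l v}).topologicalClosure
      = ⊤

/-- An isometric representation is finitely correlated if it is the minimal isometric dilation of
a representation on a nonzero finite-dimensional subspace. -/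
def IsFinitelyCorrelated (S : CorrRep A E H) : Prop :=
  S.IsIsometric ∧ ∃ (V : Submodule ℂ H) (_ : CompleteSpace V) (T : CorrRep A E V),
    V ≠ ⊥ ∧ FiniteDimensional ℂ V ∧ S.IsMinimalIsometricDilation V T

end CorrRep

/-! ## Product systems over `ℕᵏ` and their representations -/

/-- A product system of C⋆-correspondences over `ℕᵏ` with fibres `E n`, `n ∈ ℕᵏ`. The
multiplication `E n × E m → E (n + m)` is written with an explicit index `p` and a proof of
`n + m = p`. -/
structure ProductSystem (A : Type*) (k : ℕ) (E : (Fin k → ℕ) → Type*)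
    [CStarAlgebra A] [PartialOrder A] [StarOrderedRing A]
    [∀ n, NormedAddCommGroup (E n)] [∀ n, NormedSpace ℂ (E n)] [∀ n, CompleteSpace (E n)]
    [∀ n, Module Aᵐᵒᵖ (E n)] [∀ n, CStarCorrespondence A (E n)] where
  /-- the multiplication -/
  mul {n m p : Fin k → ℕ} (h : n + m = p) : E n →ₗ[ℂ] E m →ₗ[ℂ] E p
  mul_assoc {n m l nm ml p : Fin k → ℕ} (h₁ : n + m = nm) (h₂ : nm + l = p) (h₃ : m + l = ml)
    (h₄ : n + ml = p) (ξ : E n) (η : E m) (ζ : E l) :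
    mul h₂ (mul h₁ ξ η) ζ = mul h₄ ξ (mul h₃ η ζ)
  /-- the multiplication is compatible with the left and right actions of `A`, balanced over `A`,
  preserves the inner product `⟪ξ ⊗ η, ξ' ⊗ η'⟫ = ⟪η, ⟪ξ, ξ'⟫ η'⟫` of the interior tensor product
  and has dense range: it extends to an isomorphism from `E n ⊗ E m` onto `E (n + m)` -/
  lact_mul {n m p : Fin k → ℕ} (h : n + m = p) (a : A) (ξ : E n) (η : E m) :
    lact a (mul h ξ η) = mul h (lact a ξ) η
  mul_ract {n m p : Fin k → ℕ} (h : n + m = p) (a : A) (ξ : E n) (η : E m) :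
    MulOpposite.op a • mul h ξ η = mul h ξ (MulOpposite.op a • η)
  balanced {n m p : Fin k → ℕ} (h : n + m = p) (a : A) (ξ : E n) (η : E m) :
    mul h (MulOpposite.op a • ξ) η = mul h ξ (lact a η)
  inner_mul {n m p : Fin k → ℕ} (h : n + m = p) (ξ ξ' : E n) (η η' : E m) :
    ⟪mul h ξ η, mul h ξ' η'⟫_A = ⟪η, lact ⟪ξ, ξ'⟫_A η'⟫_A
  dense_mul {n m p : Fin k → ℕ} (h : n + m = p) :
    (Submodule.span ℂ {x : E p | ∃ ξ η, x = mul h ξ η}).topologicalClosure = ⊤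
  /-- the identification of `A` (as a C⋆-correspondence over itself) with `E 0`; multiplication by
  elements of `A = E 0` is the left, respectively right, action -/
  unit : A ≃ₗ[ℂ] E 0
  inner_unit (a b : A) : ⟪unit a, unit b⟫_A = star a * b
  lact_unit (a b : A) : lact a (unit b) = unit (a * b)
  ract_unit (a b : A) : MulOpposite.op a • unit b = unit (b * a)
  unit_mul {n : Fin k → ℕ} (a : A) (ξ : E n) : mul (zero_add n) (unit a) ξ = lact a ξ
  mul_unit {n : Fin k → ℕ} (a : A) (ξ : E n) :
    mul (add_zero n) ξ (unit a) = MulOpposite.op a • ξ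

/-- The `i`-th standard generator `eᵢ` of `ℕᵏ`. -/
abbrev stdGen {k : ℕ} (i : Fin k) : Fin k → ℕ := Pi.single i 1

/-- A (completely contractive covariant) representation `(S⁽¹⁾, …, S⁽ᵏ⁾, ρ)` on `H` of a product
system. -/
structure ProductSystem.Rep {A : Type*} {k : ℕ} {E : (Fin k → ℕ) → Type*}
    [CStarAlgebra A] [PartialOrder A] [StarOrderedRing A]
    [∀ n, NormedAddCommGroup (E n)] [∀ n, NormedSpace ℂ (E n)] [∀ n, CompleteSpace (E n)]
    [∀ n, Module Aᵐᵒᵖ (E n)] [∀ n, CStarCorrespondence A (E n)]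
    (P : ProductSystem A k E)
    (H : Type*) [NormedAddCommGroup H] [InnerProductSpace ℂ H] [CompleteSpace H] where
  /-- the unital representation `ρ` of `A` -/
  rho : A →⋆ₐ[ℂ] (H →L[ℂ] H)
  /-- the representation `(S⁽ⁱ⁾, ρ)` of `Eᵢ = E eᵢ` -/
  coord (i : Fin k) : CorrRep A (E (stdGen i)) H
  coord_rho (i : Fin k) : (coord i).rho = rho
  /-- The commutation relation `S̃⁽ⁱ⁾ (I ⊗ S̃⁽ʲ⁾) = S̃⁽ʲ⁾ (I ⊗ S̃⁽ⁱ⁾) (t_{ij} ⊗ I)`. Both sides are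
  operators from `Eᵢ ⊗ Eⱼ ⊗ H = E (eᵢ + eⱼ) ⊗ H` to `H`; the left one sends `ξ η ⊗ h` to
  `S⁽ⁱ⁾(ξ) S⁽ʲ⁾(η) h`, the right one sends `η ξ ⊗ h` to `S⁽ʲ⁾(η) S⁽ⁱ⁾(ξ) h`, for `ξ ∈ Eᵢ` and
  `η ∈ Eⱼ`. They agree if and only if one bounded linear map `B` on `E (eᵢ + eⱼ)`, necessarily
  unique, is given by both formulas. -/
  comm (i j : Fin k) (hij : i ≠ j) :
    ∃ B : E (stdGen i + stdGen j) →L[ℂ] (H →L[ℂ] H),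
      (∀ ξ η, B (P.mul rfl ξ η) = (coord i).map ξ * (coord j).map η) ∧
      (∀ ξ η, B (P.mul (add_comm _ _) η ξ) = (coord j).map η * (coord i).map ξ)

namespace ProductSystem.Rep

variable {A : Type*} {k : ℕ} {E : (Fin k → ℕ) → Type*}
  [CStarAlgebra A] [PartialOrder A] [StarOrderedRing A]
  [∀ n, NormedAddCommGroup (E n)] [∀ n, NormedSpace ℂ (E n)] [∀ n, CompleteSpace (E n)]
  [∀ n, Module Aᵐᵒᵖ (E n)] [∀ n, CStarCorrespondence A (E n)]
  {P : ProductSystem A k E}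
  {H : Type*} [NormedAddCommGroup H] [InnerProductSpace ℂ H] [CompleteSpace H]

/-- Every `(S⁽ⁱ⁾, ρ)` is isometric. -/
def IsIsometric (S : P.Rep H) : Prop := ∀ i, (S.coord i).IsIsometric

/-- Every `(S⁽ⁱ⁾, ρ)` is fully coisometric. -/
def IsFullyCoisometric (S : P.Rep H) : Prop := ∀ i, (S.coord i).IsFullyCoisometric

/-- The unital WOT-closed algebra generated by the representation. -/
def wotAlg (S : P.Rep H) : Set (H →L[ℂ] H) :=
  wotAlgebra ((⋃ i, Set.range (S.coord i).map) ∪ Set.range S.rho)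

theorem map_mem_wotAlg (S : P.Rep H) (i : Fin k) (ξ : E (stdGen i)) :
    (S.coord i).map ξ ∈ S.wotAlg :=
  subset_wotAlgebra _ (Or.inl (Set.mem_iUnion.mpr ⟨i, ξ, rfl⟩))

theorem rho_mem_wotAlg (S : P.Rep H) (a : A) : S.rho a ∈ S.wotAlg :=
  subset_wotAlgebra _ (Or.inr ⟨a, rfl⟩)

theorem rho_mem_of_starInvariant (S : P.Rep H) {V : Submodule ℂ H}
    (hV : StarInvariant S.wotAlg V) (a : A) (v : H) (hv : v ∈ V) : S.rho a v ∈ V := by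
  have := hV _ (S.rho_mem_wotAlg (star a)) v hv
  rwa [← ContinuousLinearMap.star_eq_adjoint, ← map_star, star_star] at this

/-- The compression `(P_V S⁽¹⁾(·)|_V, …, P_V S⁽ᵏ⁾(·)|_V, ρ(·)|_V)` to a coinvariant subspace. -/
noncomputable def compress (S : P.Rep H) (V : Submodule ℂ H) [CompleteSpace V]
    (hV : StarInvariant S.wotAlg V) : P.Rep V where
  rho := restrictRho S.rho V (S.rho_mem_of_starInvariant hV)
  coord i := (S.coord i).compress V
    (by rw [S.coord_rho i]; exact S.rho_mem_of_starInvariant hV)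
  coord_rho i := by
    ext a v
    change (compressOp V ((S.coord i).rho a) v : H) = compressOp V (S.rho a) v
    rw [S.coord_rho i]
  comm i j hij := by
    obtain ⟨B, h₁, h₂⟩ := S.comm i j hij
    refine ⟨(ContinuousLinearMap.compL ℂ V H V V.orthogonalProjectionOnto) ∘L
      ((ContinuousLinearMap.compL ℂ V H H).flip V.subtypeL) ∘L B, fun ξ η => ?_, fun ξ η => ?_⟩
    · change compressOp V (B _) = compressOp V _ * compressOp V _
      rw [h₁, compressOp_mul_of_orthogonal V _ _
        (fun x hx => hV.orthogonal (S.map_mem_wotAlg i ξ) hx)]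
    · change compressOp V (B _) = compressOp V _ * compressOp V _
      rw [h₂, compressOp_mul_of_orthogonal V _ _
        (fun x hx => hV.orthogonal (S.map_mem_wotAlg j η) hx)]

/-- `S` is a dilation of `T`: each `(S⁽ⁱ⁾, ρ)` dilates `(T⁽ⁱ⁾, σ)`. (The first clause is part of
the second one unless `k = 0`.) -/
def IsDilation (S : P.Rep H) (V : Submodule ℂ H) [CompleteSpace V] (T : P.Rep V) : Prop :=
  ReducesTo S.rho V T.rho ∧ ∀ i, (S.coord i).IsDilation V (T.coord i)

/-- The vector `S⁽ⁱ¹⁾(ξ₁) ⋯ S⁽ⁱʳ⁾(ξᵣ) v` for a list of pairs `(iₛ, ξₛ)`, `ξₛ ∈ E_{iₛ}`. -/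
def word (S : P.Rep H) (l : List (Σ i : Fin k, E (stdGen i))) (v : H) : H :=
  l.foldr (fun ξ x => (S.coord ξ.1).map ξ.2 x) v

/-- `S` is a minimal isometric dilation of `T`: it is an isometric dilation, and `H` is the closed
span of the spaces `S̃ₙ (E n ⊗ V)`, `n ∈ ℕᵏ`. As `E n = E₁^{n₁} ⊗ ⋯ ⊗ E_k^{n_k}`, the space
`S̃ₙ (E n ⊗ V)` is spanned, up to closure, by the vectors `S⁽ⁱ¹⁾(ξ₁) ⋯ S⁽ⁱʳ⁾(ξᵣ) v` with
`i₁ ≤ ⋯ ≤ iᵣ` in which every index `i` occurs `nᵢ` times. -/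
def IsMinimalIsometricDilation (S : P.Rep H) (V : Submodule ℂ H) [CompleteSpace V]
    (T : P.Rep V) : Prop :=
  S.IsDilation V T ∧ S.IsIsometric ∧
    (Submodule.span ℂ {x : H | ∃ (l : List (Σ i : Fin k, E (stdGen i))) (v : H),
      (l.map Sigma.fst).Pairwise (· ≤ ·) ∧ v ∈ V ∧ x = S.word l v}).topologicalClosure = ⊤

/-- An isometric representation is finitely correlated if it is a minimal isometric dilation of
a representation on a nonzero finite-dimensional subspace. -/
def IsFinitelyCorrelated (S : P.Rep H) : Prop :=
  S.IsIsometric ∧ ∃ (V : Submodule ℂ H) (_ : CompleteSpace V) (T : P.Rep V),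
    V ≠ ⊥ ∧ FiniteDimensional ℂ V ∧ S.IsMinimalIsometricDilation V T

end ProductSystem.Rep

/-! The argument measures angles. Write L_i K for the closed span of S⁽ⁱ⁾(E_i)K. If M ∩ V = 0, then
compactness of the unit sphere of V gives a constant c < 1 with |⟪x, v⟫| ≤ c‖x‖‖v‖ for x ∈ M and v ∈
V (`exists_angleBound_lt_one`). The bound survives simultaneous amplification of M and V
(`IsIsometric.angleBound_ampl`): because the representation is isometric, inner products of vectors
∑ S(ξ_i)x_i are governed by a Gram matrix over A, and factoring it as B⋆B turns them into sums of
inner products of vectors that still lie in M or in V.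

A closed coinvariant subspace of an isometric, fully coisometric representation satisfies M ⊆ L_i M
(`IsFullyCoisometric.le_ampl`): S̃ is unitary and S̃⋆ maps M into E ⊗ M. Hence M makes the same
angle with every iterated amplification of V. By the commutation relations these amplifications form
a directed family, and by minimality their union is dense in H. So |⟪y, w⟫| ≤ c‖y‖‖w‖ for y ∈ M and
every w ∈ H; taking w = y ≠ 0 contradicts c < 1. A single correspondence is the case of a
one-element family. -/

/-- A finite Gram matrix over a C⋆-correspondence factors as `B⋆ B` with `B` a matrix over `A`. -/
theorem exists_gram_factorization {A E : Type*} [CStarAlgebra A] [PartialOrder A]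
    [StarOrderedRing A] [NormedAddCommGroup E] [NormedSpace ℂ E] [CompleteSpace E]
    [Module Aᵐᵒᵖ E] [CStarCorrespondence A E] {ι : Type*} [Fintype ι] (ξ : ι → E) :
    ∃ (n : ℕ) (B : Fin n → ι → A), ∀ i j, ⟪ξ i, ξ j⟫_A = ∑ k, star (B k i) * B k j := by
  -- `gram_nonneg` is indexed by `Fin n`; other index types are needed because two families are
  -- later joined into one over a disjoint sum.
  let e := Fintype.equivFin ι
  obtain ⟨B, hB⟩ := exists_star_mul_self (gram_nonneg (A := A) (ξ ∘ e.symm))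
  refine ⟨_, fun k i => B k (e i), fun i j => ?_⟩
  have := congrFun (congrFun hB (e i)) (e j)
  simpa [CStarMatrix.mul_apply, CStarMatrix.star_apply] using this

/-! ### Angles between subspaces -/

section Angle

variable {H : Type*} [NormedAddCommGroup H] [InnerProductSpace ℂ H]

/-- The cosine of the angle between `K` and `N` is at most `c`. -/
def AngleBound (c : ℝ) (K N : Submodule ℂ H) : Prop :=
  ∀ x ∈ K, ∀ y ∈ N, ‖⟪x, y⟫_ℂ‖ ≤ c * ‖x‖ * ‖y‖

theorem AngleBound.topologicalClosure {c : ℝ} {K N : Submodule ℂ H} (h : AngleBound c K N) :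
    AngleBound c K.topologicalClosure N.topologicalClosure := by
  have h₁ : ∀ x ∈ K, ∀ y ∈ N.topologicalClosure, ‖⟪x, y⟫_ℂ‖ ≤ c * ‖x‖ * ‖y‖ := by
    intro x hx
    have hc : IsClosed {y : H | ‖⟪x, y⟫_ℂ‖ ≤ c * ‖x‖ * ‖y‖} :=
      isClosed_le (by fun_prop) (by fun_prop)
    exact fun y hy => closure_minimal (fun y hy => h x hx y hy) hc hy
  intro x hx y hy
  have hc : IsClosed {x : H | ‖⟪x, y⟫_ℂ‖ ≤ c * ‖x‖ * ‖y‖} :=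
    isClosed_le (by fun_prop) (by fun_prop)
  exact closure_minimal (fun x hx => h₁ x hx y hy) hc hx

/-- A closed subspace and a finite-dimensional subspace with trivial intersection form a positive
angle. -/
theorem exists_angleBound_lt_one [CompleteSpace H] (M V : Submodule ℂ H)
    (hM : IsClosed (M : Set H)) [FiniteDimensional ℂ V] (hMV : M ⊓ V = ⊥) :
    ∃ c : ℝ, 0 ≤ c ∧ c < 1 ∧ AngleBound c M V := by
  have : CompleteSpace M := hM.completeSpace_coe
  -- The constant is the maximum of ‖P_M v‖ over the unit sphere of V. If it were 1, Pythagoras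
  -- would put the maximizing v in M ∩ V. When V = 0 the sphere is empty and c = 0 serves.
  obtain ⟨c, hc0, hc1, hc⟩ : ∃ c : ℝ, 0 ≤ c ∧ c < 1 ∧
      ∀ v : V, ‖v‖ = 1 → ‖M.starProjection (v : H)‖ ≤ c := by
    by_cases hne : (Metric.sphere (0 : V) 1).Nonempty
    · have : ProperSpace V := FiniteDimensional.proper ℂ V
      obtain ⟨v, hv, hmax⟩ := (isCompact_sphere (0 : V) 1).exists_isMaxOn hne
        (f := fun v : V => ‖M.starProjection (v : H)‖) (by fun_prop)
      have hv1 : ‖(v : H)‖ = 1 := by simpa using hv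
      refine ⟨_, norm_nonneg (M.starProjection (v : H)), lt_of_not_ge fun hge => ?_,
        fun w hw => hmax (by simpa using hw)⟩
      have hvM : (v : H) ∈ M := by
        have hle := M.norm_starProjection_apply_le (v : H)
        have hpy := Submodule.norm_sq_eq_add_norm_sq_starProjection (v : H) M
        have hz : ‖Mᗮ.starProjection (v : H)‖ = 0 := by
          rw [hv1] at hpy
          nlinarith [norm_nonneg (Mᗮ.starProjection (v : H))]
        have hs := M.starProjection_add_starProjection_orthogonal (v : H)
        rw [norm_eq_zero.mp hz, add_zero] at hs
        exact Submodule.starProjection_eq_self_iff.mp hs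
      have hv0 : (v : H) ∈ M ⊓ V := ⟨hvM, v.2⟩
      rw [hMV, Submodule.mem_bot] at hv0
      rw [hv0, norm_zero] at hv1
      exact zero_ne_one hv1
    · exact ⟨0, le_rfl, one_pos, fun v hv => (hne ⟨v, by simpa using hv⟩).elim⟩
  refine ⟨c, hc0, hc1, fun x hx v hv => ?_⟩
  have hproj : ‖M.starProjection v‖ ≤ c * ‖v‖ := by
    rcases eq_or_ne v 0 with rfl | hv0
    · simp
    · have h := hc ⟨((‖v‖⁻¹ : ℝ) : ℂ) • v, V.smul_mem _ hv⟩ (by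
        simp [norm_smul, hv0])
      simp only [map_smul, norm_smul, Complex.norm_real, norm_inv, norm_norm] at h
      rwa [inv_mul_le_iff₀ (norm_pos_iff.mpr hv0), mul_comm] at h
  have hin : ⟪x, v⟫_ℂ = ⟪x, M.starProjection v⟫_ℂ := by
    rw [← M.inner_starProjection_left_eq_right, Submodule.starProjection_eq_self_iff.mpr hx]
  rw [hin]
  calc _ ≤ ‖x‖ * ‖M.starProjection v‖ := norm_inner_le_norm _ _
    _ ≤ ‖x‖ * (c * ‖v‖) := by gcongr
    _ = c * ‖x‖ * ‖v‖ := by ring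

end Angle

/-! ### Amplification of subspaces by one representation -/

namespace CorrRep

variable {A E H : Type*} [CStarAlgebra A] [PartialOrder A] [StarOrderedRing A]
  [NormedAddCommGroup E] [NormedSpace ℂ E] [CompleteSpace E] [Module Aᵐᵒᵖ E]
  [CStarCorrespondence A E]
  [NormedAddCommGroup H] [InnerProductSpace ℂ H] [CompleteSpace H]

/-- The closed linear span `S̃ (E ⊗ K)` of the vectors `S(ξ) x` with `ξ ∈ E` and `x ∈ K`. -/
def ampl (S : CorrRep A E H) (K : Submodule ℂ H) : Submodule ℂ H :=
  (Submodule.span ℂ {y : H | ∃ ξ, ∃ x ∈ K, y = S.map ξ x}).topologicalClosure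

theorem map_mem_ampl (S : CorrRep A E H) {K : Submodule ℂ H} (ξ : E) {x : H} (hx : x ∈ K) :
    S.map ξ x ∈ S.ampl K :=
  Submodule.le_topologicalClosure _ (Submodule.subset_span ⟨ξ, x, hx, rfl⟩)

theorem isClosed_ampl (S : CorrRep A E H) (K : Submodule ℂ H) :
    IsClosed (S.ampl K : Set H) :=
  Submodule.isClosed_topologicalClosure _

theorem ampl_le_iff (S : CorrRep A E H) {K N : Submodule ℂ H} (hN : IsClosed (N : Set H)) :
    S.ampl K ≤ N ↔ ∀ ξ, ∀ x ∈ K, S.map ξ x ∈ N := by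
  refine ⟨fun h ξ x hx => h (S.map_mem_ampl ξ hx), fun h => ?_⟩
  refine Submodule.topologicalClosure_minimal _ (Submodule.span_le.mpr ?_) hN
  rintro _ ⟨ξ, x, hx, rfl⟩
  exact h ξ x hx

theorem ampl_mono (S : CorrRep A E H) {K N : Submodule ℂ H} (h : K ≤ N) :
    S.ampl K ≤ S.ampl N :=
  (S.ampl_le_iff (S.isClosed_ampl N)).mpr fun ξ _ hx => S.map_mem_ampl ξ (h hx)

/-- The left action absorbs a: ρ(a)S(ξ) = S(aξ), by covariance with b = 1. This provides the
ρ-invariance needed to amplify repeatedly. -/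
theorem rho_mem_ampl (S : CorrRep A E H) {K : Submodule ℂ H} (a : A) {y : H}
    (hy : y ∈ S.ampl K) : S.rho a y ∈ S.ampl K := by
  have hcl : IsClosed ((S.ampl K).comap (S.rho a).toLinearMap : Set H) :=
    (S.isClosed_ampl K).preimage (S.rho a).continuous
  refine (S.ampl_le_iff hcl).mpr (fun ξ x hx => ?_) hy
  have h := DFunLike.congr_fun (S.covariant a 1 ξ) x
  rw [MulOpposite.op_one, one_smul, map_one, mul_one] at h
  change S.rho a (S.map ξ x) ∈ S.ampl K
  rw [← mul_apply_eq_comp, ← h]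
  exact S.map_mem_ampl _ hx

theorem IsIsometric.inner_map {S : CorrRep A E H} (hS : S.IsIsometric) (ξ η : E) (x y : H) :
    ⟪S.map ξ x, S.map η y⟫_ℂ = ⟪x, S.rho ⟪ξ, η⟫_A y⟫_ℂ := by
  rw [← hS ξ η, mul_apply_eq_comp, ContinuousLinearMap.adjoint_inner_right]

theorem mem_span_map (S : CorrRep A E H) {K : Submodule ℂ H} {y : H}
    (hy : y ∈ Submodule.span ℂ {y : H | ∃ ξ, ∃ x ∈ K, y = S.map ξ x}) :
    ∃ (n : ℕ) (ξ : Fin n → E) (x : Fin n → H), (∀ i, x i ∈ K) ∧ y = ∑ i, S.map (ξ i) (x i) := by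
  obtain ⟨n, f, g, rfl⟩ := Submodule.mem_span_set'.mp hy
  choose ξ x hx hg using fun i => (g i).2
  refine ⟨n, ξ, fun i => f i • x i, fun i => K.smul_mem _ (hx i), ?_⟩
  simp [hg]

/-- For an isometric representation, passing from two `ρ`-invariant subspaces `K`, `N` to
`S̃ (E ⊗ K)`, `S̃ (E ⊗ N)` does not decrease the angle between them. -/
theorem IsIsometric.angleBound_ampl {S : CorrRep A E H} (hS : S.IsIsometric) {c : ℝ} (hc : 0 ≤ c)
    {K N : Submodule ℂ H} (hK : ∀ a, ∀ x ∈ K, S.rho a x ∈ K) (hN : ∀ a, ∀ x ∈ N, S.rho a x ∈ N)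
    (h : AngleBound c K N) : AngleBound c (S.ampl K) (S.ampl N) := by
  refine AngleBound.topologicalClosure fun y hy z hz => ?_
  -- By continuity it suffices to treat finite sums. Joining ξ and η into one family lets a single B
  -- describe both norms and the mixed inner product.
  obtain ⟨n, ξ, x, hx, rfl⟩ := S.mem_span_map hy
  obtain ⟨m, η, w, hw, rfl⟩ := S.mem_span_map hz
  obtain ⟨r, B, hB⟩ := exists_gram_factorization (A := A) (Sum.elim ξ η)
  -- The map ∑ S(ξ_i)u_i ↦ (∑ ρ(B_{ki})u_i)_k into H^r preserves inner products, and its components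
  -- stay in any ρ-invariant subspace containing all u_i.
  have key : ∀ u v : Fin n ⊕ Fin m → H,
      ⟪∑ i, S.map (Sum.elim ξ η i) (u i), ∑ i, S.map (Sum.elim ξ η i) (v i)⟫_ℂ
        = ∑ k, ⟪∑ i, S.rho (B k i) (u i), ∑ i, S.rho (B k i) (v i)⟫_ℂ := by
    intro u v
    simp only [sum_inner, inner_sum, hS.inner_map, hB, map_sum, map_mul, map_star,
      _root_.sum_apply, mul_apply_eq_comp,
      ContinuousLinearMap.star_eq_adjoint, ContinuousLinearMap.adjoint_inner_right]
    rw [Finset.sum_congr rfl fun _ _ => Finset.sum_comm, Finset.sum_comm]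
  have hnorm : ∀ u : Fin n ⊕ Fin m → H, ‖∑ i, S.map (Sum.elim ξ η i) (u i)‖ ^ 2
      = ∑ k, ‖∑ i, S.rho (B k i) (u i)‖ ^ 2 := by
    intro u
    have := key u u
    simp only [inner_self_eq_norm_sq_to_K] at this
    exact_mod_cast this
  -- Padding by zero writes both vectors over the joint family, with all coefficients still in K,
  -- respectively N.
  have hy' : ∑ i, S.map (ξ i) (x i) = ∑ i, S.map (Sum.elim ξ η i) (Sum.elim x 0 i) := by simp
  have hz' : ∑ i, S.map (η i) (w i) = ∑ i, S.map (Sum.elim ξ η i) (Sum.elim 0 w i) := by simp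
  have hu : ∀ i, Sum.elim x (0 : Fin m → H) i ∈ K := by
    rintro (i | i)
    exacts [hx i, K.zero_mem]
  have hv : ∀ i, Sum.elim (0 : Fin n → H) w i ∈ N := by
    rintro (i | i)
    exacts [N.zero_mem, hw i]
  rw [hy', hz']
  generalize Sum.elim x (0 : Fin m → H) = u at hu
  generalize Sum.elim (0 : Fin n → H) w = v at hv
  -- The angle bound applies in each component k; Cauchy–Schwarz over k reassembles the two norms
  -- with the same constant c.
  have hcs := Real.sum_mul_le_sqrt_mul_sqrt Finset.univ
    (fun k => ‖∑ i, S.rho (B k i) (u i)‖) (fun k => ‖∑ i, S.rho (B k i) (v i)‖)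
  rw [← hnorm, ← hnorm, Real.sqrt_sq (norm_nonneg _), Real.sqrt_sq (norm_nonneg _)] at hcs
  rw [key]
  calc _ ≤ ∑ k, c * (‖∑ i, S.rho (B k i) (u i)‖ * ‖∑ i, S.rho (B k i) (v i)‖) := by
        refine (norm_sum_le _ _).trans (Finset.sum_le_sum fun k _ => ?_)
        rw [← mul_assoc]
        exact h _ (K.sum_mem fun i _ => hK _ _ (hu i)) _ (N.sum_mem fun i _ => hN _ _ (hv i))
    _ ≤ _ := by
        rw [← Finset.mul_sum, mul_assoc]
        gcongr

/-- A coisometry is onto, and the range of S̃ lies in the closed span of the images of elementary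
tensors. -/
theorem IsFullyCoisometric.ampl_top {S : CorrRep A E H} (hS : S.IsFullyCoisometric) :
    S.ampl ⊤ = ⊤ := by
  obtain ⟨St, hSt, hco⟩ := hS
  have hmem : ∀ t, St t ∈ S.ampl ⊤ := by
    intro t
    induction t using UniformSpace.Completion.induction_on with
    | hp => exact (S.isClosed_ampl ⊤).preimage St.continuous
    | ih t =>
      change E ⊗[ℂ] H at t
      induction t using TensorProduct.induction_on with
      | zero =>
        have h0 : ((show PreTensor E S.rho from (0 : E ⊗[ℂ] H) : PreTensor E S.rho) :
            TensorHilbert E S.rho) = 0 := UniformSpace.Completion.coe_zero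
        rw [h0, map_zero]
        exact Submodule.zero_mem _
      | tmul ξ h =>
        have := hSt ξ h
        unfold tensorMk at this
        rw [this]
        exact S.map_mem_ampl ξ trivial
      | add s t hs ht =>
        have h0 : ((show PreTensor E S.rho from (s + t : E ⊗[ℂ] H) : PreTensor E S.rho) :
            TensorHilbert E S.rho) = ((show PreTensor E S.rho from s : PreTensor E S.rho) :
            TensorHilbert E S.rho) + ((show PreTensor E S.rho from t : PreTensor E S.rho) :
            TensorHilbert E S.rho) := UniformSpace.Completion.coe_add _ _
        rw [h0, map_add]
        exact Submodule.add_mem _ hs ht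
  refine Submodule.eq_top_iff'.mpr fun y => ?_
  have := DFunLike.congr_fun hco y
  rw [ContinuousLinearMap.comp_apply, ContinuousLinearMap.id_apply] at this
  rw [← this]
  exact hmem _

/-- A closed `ρ`-reducing coinvariant subspace `M` is contained in `S̃ (E ⊗ M)`. -/
theorem IsFullyCoisometric.le_ampl {S : CorrRep A E H} (hco : S.IsFullyCoisometric)
    (hiso : S.IsIsometric) {M : Submodule ℂ H} (hM : IsClosed (M : Set H))
    (hrho : ∀ a, ∀ x ∈ M, S.rho a x ∈ M)
    (hadj : ∀ ξ, ∀ x ∈ M, ContinuousLinearMap.adjoint (S.map ξ) x ∈ M) : M ≤ S.ampl M := by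
  intro y hy
  have : CompleteSpace M := hM.completeSpace_coe
  have : CompleteSpace (S.ampl M) := (S.isClosed_ampl M).completeSpace_coe
  -- It is enough that z is orthogonal to S̃(E ⊗ H), which is all of H, for then z = 0.
  set z := y - (S.ampl M).starProjection y with hz
  have hz₁ : z ∈ (S.ampl M)ᗮ := Submodule.sub_starProjection_mem_orthogonal y
  -- The inner product of S(η)x and S(ξ)m is ⟪x, ρ(⟪η, ξ⟫)m⟫, which vanishes because ρ preserves M.
  have horth : ∀ η, ∀ x ∈ Mᗮ, S.map η x ∈ (S.ampl M)ᗮ := by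
    intro η x hx
    have : S.ampl M ≤ (Submodule.span ℂ {S.map η x})ᗮ := by
      refine (S.ampl_le_iff (Submodule.isClosed_orthogonal _)).mpr fun ξ m hm => ?_
      rw [Submodule.mem_orthogonal_singleton_iff_inner_right, hiso.inner_map]
      rw [← inner_conj_symm, Submodule.inner_right_of_mem_orthogonal (hrho _ m hm) hx, map_zero]
    rw [Submodule.mem_orthogonal]
    intro u hu
    exact Submodule.mem_orthogonal_singleton_iff_inner_left.mp (this hu)
  have hz₂ : S.ampl ⊤ ≤ (Submodule.span ℂ {z})ᗮ := by
    refine (S.ampl_le_iff (Submodule.isClosed_orthogonal _)).mpr fun η x _ => ?_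
    rw [Submodule.mem_orthogonal_singleton_iff_inner_right]
    -- Split x along M and Mᗮ. The M-part is sent into S̃(E ⊗ M), orthogonal to z. The Mᗮ-part is
    -- sent to a vector orthogonal to y, since S(η)⋆y ∈ M, and to the projection of y, by `horth`.
    have hx := M.starProjection_add_starProjection_orthogonal x
    have h₁ : M.starProjection x ∈ M := Submodule.starProjection_apply_mem _ _
    have h₂ : Mᗮ.starProjection x ∈ Mᗮ := Submodule.starProjection_apply_mem _ _
    rw [← hx, map_add, _root_.inner_add_right,
      Submodule.inner_left_of_mem_orthogonal (S.map_mem_ampl η h₁) hz₁, zero_add, hz,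
      inner_sub_left, ← ContinuousLinearMap.adjoint_inner_left,
      Submodule.inner_right_of_mem_orthogonal (hadj η y hy) h₂,
      Submodule.inner_right_of_mem_orthogonal (Submodule.starProjection_apply_mem _ _)
        (horth η _ h₂), sub_zero]
  rw [hco.ampl_top] at hz₂
  have hz₃ : z = 0 := inner_self_eq_zero.mp
    (Submodule.mem_orthogonal_singleton_iff_inner_right.mp (hz₂ (Submodule.mem_top (x := z))))
  rw [sub_eq_zero.mp hz₃]
  exact Submodule.starProjection_apply_mem _ _

end CorrRep

/-! ### Iterated amplification and the angle argument for commuting families -/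

section Family

variable {A ι H : Type*} {E : ι → Type*} [CStarAlgebra A] [PartialOrder A] [StarOrderedRing A]
  [∀ i, NormedAddCommGroup (E i)] [∀ i, NormedSpace ℂ (E i)] [∀ i, CompleteSpace (E i)]
  [∀ i, Module Aᵐᵒᵖ (E i)] [∀ i, CStarCorrespondence A (E i)]
  [NormedAddCommGroup H] [InnerProductSpace ℂ H] [CompleteSpace H]

/-- The iterated amplification `L_{i₁} ⋯ L_{iᵣ} K`, where `L_i K` is the closed span of
`S⁽ⁱ⁾(E_i) K`. -/
def iterAmpl (S : ∀ i, CorrRep A (E i) H) (l : List ι) (K : Submodule ℂ H) : Submodule ℂ H :=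
  l.foldr (fun i N => (S i).ampl N) K

variable {S : ∀ i, CorrRep A (E i) H}

theorem iterAmpl_mono (l : List ι) {K N : Submodule ℂ H} (h : K ≤ N) :
    iterAmpl S l K ≤ iterAmpl S l N := by
  induction l with
  | nil => exact h
  | cons i l ih => exact (S i).ampl_mono ih

theorem le_iterAmpl {K : Submodule ℂ H} (hK : ∀ i, K ≤ (S i).ampl K) (l : List ι) :
    K ≤ iterAmpl S l K := by
  induction l with
  | nil => exact le_rfl
  | cons i l ih => exact (hK i).trans ((S i).ampl_mono ih)

theorem iterAmpl_append (l l' : List ι) (K : Submodule ℂ H) :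
    iterAmpl S (l ++ l') K = iterAmpl S l (iterAmpl S l' K) :=
  List.foldr_append

/-- The new L_i starts next to K, where K ⊆ L_i K, and is moved outwards past each L_j by
commutation. -/
theorem iterAmpl_le_ampl
    (hcomm : ∀ i j K, (S i).ampl ((S j).ampl K) ≤ (S j).ampl ((S i).ampl K))
    {K : Submodule ℂ H} (hK : ∀ i, K ≤ (S i).ampl K) (i : ι) (l : List ι) :
    iterAmpl S l K ≤ (S i).ampl (iterAmpl S l K) := by
  induction l with
  | nil => exact hK i
  | cons j l ih => exact ((S j).ampl_mono ih).trans (hcomm j i _)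

/-- The concatenation l ++ l' dominates both: l by enlarging the innermost K to L_{l'} K, and l'
because L_{l'} K is again contained in each of its amplifications. Directedness makes the supremum a
union, so that an angle bound can be checked on each member. -/
theorem directed_iterAmpl
    (hcomm : ∀ i j K, (S i).ampl ((S j).ampl K) ≤ (S j).ampl ((S i).ampl K))
    {K : Submodule ℂ H} (hK : ∀ i, K ≤ (S i).ampl K) :
    Directed (· ≤ ·) fun l : List ι => iterAmpl S l K := by
  refine fun l l' => ⟨l ++ l', ?_, ?_⟩
  · simp only [iterAmpl_append]
    exact iterAmpl_mono l (le_iterAmpl hK l')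
  · simp only [iterAmpl_append]
    exact le_iterAmpl (fun i => iterAmpl_le_ampl hcomm hK i l') l

theorem rho_mem_iterAmpl {ρ : A →⋆ₐ[ℂ] (H →L[ℂ] H)} (hρ : ∀ i, (S i).rho = ρ)
    {K : Submodule ℂ H} (hK : ∀ a, ∀ x ∈ K, ρ a x ∈ K) (l : List ι) (a : A) (x : H)
    (hx : x ∈ iterAmpl S l K) : ρ a x ∈ iterAmpl S l K := by
  cases l with
  | nil => exact hK a x hx
  | cons i l =>
    rw [← hρ i]
    exact (S i).rho_mem_ampl a hx

theorem angleBound_iterAmpl (hiso : ∀ i, (S i).IsIsometric) {ρ : A →⋆ₐ[ℂ] (H →L[ℂ] H)}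
    (hρ : ∀ i, (S i).rho = ρ) {c : ℝ} (hc : 0 ≤ c) {K N : Submodule ℂ H}
    (hK : ∀ a, ∀ x ∈ K, ρ a x ∈ K) (hN : ∀ a, ∀ x ∈ N, ρ a x ∈ N) (h : AngleBound c K N)
    (l : List ι) : AngleBound c (iterAmpl S l K) (iterAmpl S l N) := by
  induction l with
  | nil => exact h
  | cons i l ih =>
    refine (hiso i).angleBound_ampl hc ?_ ?_ ih
    · rw [hρ i]
      exact rho_mem_iterAmpl hρ hK l
    · rw [hρ i]
      exact rho_mem_iterAmpl hρ hN l

/-- A closed coinvariant subspace which meets `V` trivially is zero, if the amplifications of the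
finite-dimensional coinvariant subspace `V` exhaust `H`. -/
theorem inf_ne_bot_of_dense_iterAmpl {ρ : A →⋆ₐ[ℂ] (H →L[ℂ] H)}
    (hρ : ∀ i, (S i).rho = ρ) (hiso : ∀ i, (S i).IsIsometric)
    (hco : ∀ i, (S i).IsFullyCoisometric)
    (hcomm : ∀ i j K, (S i).ampl ((S j).ampl K) ≤ (S j).ampl ((S i).ampl K))
    {V M : Submodule ℂ H} [FiniteDimensional ℂ V]
    (hVρ : ∀ a, ∀ x ∈ V, ρ a x ∈ V)
    (hV : ∀ i ξ, ∀ x ∈ V, ContinuousLinearMap.adjoint ((S i).map ξ) x ∈ V)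
    (hdense : (⨆ l, iterAmpl S l V).topologicalClosure = ⊤)
    (hMcl : IsClosed (M : Set H)) (hM0 : M ≠ ⊥) (hMρ : ∀ a, ∀ x ∈ M, ρ a x ∈ M)
    (hM : ∀ i ξ, ∀ x ∈ M, ContinuousLinearMap.adjoint ((S i).map ξ) x ∈ M) :
    M ⊓ V ≠ ⊥ := by
  intro hMV
  obtain ⟨c, hc0, hc1, hc⟩ := exists_angleBound_lt_one M V hMcl hMV
  obtain ⟨y, hy, hy0⟩ := M.ne_bot_iff.mp hM0
  have hVle : ∀ i, V ≤ (S i).ampl V := fun i =>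
    (hco i).le_ampl (hiso i) V.closed_of_finiteDimensional (by rwa [hρ i]) (hV i)
  have hMle : ∀ i, M ≤ (S i).ampl M := fun i =>
    (hco i).le_ampl (hiso i) hMcl (by rwa [hρ i]) (hM i)
  have hcl : IsClosed {w : H | ‖⟪y, w⟫_ℂ‖ ≤ c * ‖y‖ * ‖w‖} :=
    isClosed_le (by fun_prop) (by fun_prop)
  have hsub : ((⨆ l, iterAmpl S l V : Submodule ℂ H) : Set H)
      ⊆ {w : H | ‖⟪y, w⟫_ℂ‖ ≤ c * ‖y‖ * ‖w‖} := by
    intro w hw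
    obtain ⟨l, hl⟩ := (Submodule.mem_iSup_of_directed _ (directed_iterAmpl hcomm hVle)).mp hw
    -- Amplify M along the same list l as V; y ∈ M remains in the amplified M.
    exact angleBound_iterAmpl hiso hρ hc0 hMρ hVρ hc l y (le_iterAmpl hMle l hy) w hl
  have hyy : y ∈ (⨆ l, iterAmpl S l V).topologicalClosure := by
    rw [hdense]
    trivial
  have h := closure_minimal hsub hcl hyy
  have hpos : 0 < ‖y‖ := norm_pos_iff.mpr hy0
  simp only [Set.mem_ofPred_eq, inner_self_eq_norm_sq_to_K] at h
  norm_num at h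
  -- With w = y the bound reads ‖y‖² ≤ c‖y‖², impossible for c < 1 and y ≠ 0.
  nlinarith [mul_pos hpos hpos]

end Family

/-! ### Commutation in product systems, and the two conclusions -/

/-- S⁽ⁱ⁾(ξ)S⁽ʲ⁾(η) = B(ξη), and ξη is a limit of sums of products η'ξ' taken in the other order, on
which B equals S⁽ʲ⁾(η')S⁽ⁱ⁾(ξ'). Continuity of B carries the inclusion to the limit. -/
theorem ProductSystem.Rep.ampl_comm {A : Type*} {k : ℕ} {E : (Fin k → ℕ) → Type*}
    [CStarAlgebra A] [PartialOrder A] [StarOrderedRing A]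
    [∀ n, NormedAddCommGroup (E n)] [∀ n, NormedSpace ℂ (E n)] [∀ n, CompleteSpace (E n)]
    [∀ n, Module Aᵐᵒᵖ (E n)] [∀ n, CStarCorrespondence A (E n)]
    {P : ProductSystem A k E} {H : Type*} [NormedAddCommGroup H] [InnerProductSpace ℂ H]
    [CompleteSpace H] (S : P.Rep H) (i j : Fin k) (K : Submodule ℂ H) :
    (S.coord i).ampl ((S.coord j).ampl K) ≤ (S.coord j).ampl ((S.coord i).ampl K) := by
  rcases eq_or_ne i j with rfl | hij
  · exact le_rfl
  obtain ⟨B, hB₁, hB₂⟩ := S.comm i j hij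
  set N := (S.coord j).ampl ((S.coord i).ampl K)
  have hN : IsClosed (N : Set H) := (S.coord j).isClosed_ampl _
  refine ((S.coord i).ampl_le_iff hN).mpr fun ξ => ?_
  have hcl : IsClosed (N.comap ((S.coord i).map ξ).toLinearMap : Set H) :=
    hN.preimage ((S.coord i).map ξ).continuous
  refine ((S.coord j).ampl_le_iff hcl).mpr fun η x hx => ?_
  change (S.coord i).map ξ ((S.coord j).map η x) ∈ N
  rw [← mul_apply_eq_comp, ← hB₁]
  have hcl' : IsClosed (N.comap (B.flip x).toLinearMap : Set (E (stdGen i + stdGen j))) :=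
    hN.preimage (B.flip x).continuous
  -- Every ζ in the fibre satisfies B(ζ)x ∈ N: this is a closed linear condition on ζ, and it holds
  -- on the dense span of the products η'ξ'.
  have htop : (⊤ : Submodule ℂ (E (stdGen i + stdGen j))) ≤ N.comap (B.flip x).toLinearMap := by
    rw [← P.dense_mul (add_comm (stdGen j) (stdGen i))]
    refine Submodule.topologicalClosure_minimal _ (Submodule.span_le.mpr ?_) hcl'
    rintro _ ⟨η', ξ', rfl⟩
    change B (P.mul _ η' ξ') x ∈ N
    rw [hB₂]
    exact (S.coord j).map_mem_ampl _ ((S.coord i).map_mem_ampl _ hx)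
  exact htop (Submodule.mem_top (x := P.mul rfl ξ η))

theorem mainTheorem8
    {A : Type*} [CStarAlgebra A] [PartialOrder A] [StarOrderedRing A]
    {H : Type*} [NormedAddCommGroup H] [InnerProductSpace ℂ H] [CompleteSpace H] :
    -- representations of a single C⋆-correspondence
    (∀ (E : Type*) [NormedAddCommGroup E] [NormedSpace ℂ E] [CompleteSpace E] [Module Aᵐᵒᵖ E]
        [CStarCorrespondence A E]
        (S : CorrRep A E H), S.IsFinitelyCorrelated → S.IsFullyCoisometric →
      ∀ (V : Submodule ℂ H) [CompleteSpace V] [FiniteDimensional ℂ V]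
        (hV : StarInvariant S.wotAlg V),
        S.IsMinimalIsometricDilation V (S.compress V (S.rho_mem_of_starInvariant hV)) →
      ∀ M : Submodule ℂ H, IsClosed (M : Set H) → M ≠ ⊥ → StarInvariant S.wotAlg M →
        M ⊓ V ≠ ⊥) ∧
    -- representations of a product system of C⋆-correspondences over `ℕᵏ`
    (∀ (k : ℕ) (E : (Fin k → ℕ) → Type*) [∀ n, NormedAddCommGroup (E n)]
        [∀ n, NormedSpace ℂ (E n)] [∀ n, CompleteSpace (E n)] [∀ n, Module Aᵐᵒᵖ (E n)]
        [∀ n, CStarCorrespondence A (E n)] (P : ProductSystem A k E)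
        (S : P.Rep H), S.IsFinitelyCorrelated → S.IsFullyCoisometric →
      ∀ (V : Submodule ℂ H) [CompleteSpace V] [FiniteDimensional ℂ V]
        (hV : StarInvariant S.wotAlg V),
        S.IsMinimalIsometricDilation V (S.compress V hV) →
      ∀ M : Submodule ℂ H, IsClosed (M : Set H) → M ≠ ⊥ → StarInvariant S.wotAlg M →
        M ⊓ V ≠ ⊥) := by
  refine ⟨?_, ?_⟩
  · intro E _ _ _ _ _ S _ hco V _ _ hV hmin M hMcl hM0 hM
    -- A one-element family, for which commutation is trivial and lists only record a length.
    refine inf_ne_bot_of_dense_iterAmpl (ι := Unit) (S := fun _ => S) (ρ := S.rho)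
      (fun _ => rfl) (fun _ => hmin.2.1) (fun _ => hco) (fun _ _ _ => le_rfl)
      (S.rho_mem_of_starInvariant hV) (fun _ ξ => hV _ (S.map_mem_wotAlg ξ)) ?_ hMcl hM0
      (S.rho_mem_of_starInvariant hM) (fun _ ξ => hM _ (S.map_mem_wotAlg ξ))
    rw [eq_top_iff, ← hmin.2.2]
    refine Submodule.topologicalClosure_mono (Submodule.span_le.mpr ?_)
    rintro _ ⟨l, v, hv, rfl⟩
    -- A word of length n applied to v ∈ V lies in the n-fold amplification of V.
    refine Submodule.mem_iSup_of_mem (l.map fun _ => ()) ?_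
    induction l with
    | nil => exact hv
    | cons ξ l ih => exact S.map_mem_ampl ξ ih
  · intro k E _ _ _ _ _ P S _ hco V _ _ hV hmin M hMcl hM0 hM
    refine inf_ne_bot_of_dense_iterAmpl (S := S.coord) (ρ := S.rho)
      S.coord_rho hmin.2.1 hco S.ampl_comm
      (S.rho_mem_of_starInvariant hV) (fun i ξ => hV _ (S.map_mem_wotAlg i ξ)) ?_ hMcl hM0
      (S.rho_mem_of_starInvariant hM) (fun i ξ => hM _ (S.map_mem_wotAlg i ξ))
    rw [eq_top_iff, ← hmin.2.2]
    refine Submodule.topologicalClosure_mono (Submodule.span_le.mpr ?_)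
    rintro _ ⟨l, v, -, hv, rfl⟩
    -- A word lies in the amplification of V along its own list of indices.
    refine Submodule.mem_iSup_of_mem (l.map Sigma.fst) ?_
    induction l with
    | nil => exact hv
    | cons ξ l ih => exact (S.coord ξ.1).map_mem_ampl ξ.2 ih
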